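/- **Theorem 3.3.** For a set $C$ of ordinals let $\operatorname{otp}(C)$ be its order type, let $\operatorname{acc}(C)=\{\beta\in C\mid \beta\neq 0,\ \sup(C\cap\beta)=\beta\}$, and for $i<\operatorname{otp}(C)$ let $C(i)$ be the $i$-th element of $C$, i.e. the unique $\beta\in C$ with $\operatorname{otp}(C\cap\beta)=i$. A club in an ordinal $\delta$ is a cofinal subset of $\delta$ that contains each nonzero $\beta<\delta$ with $\sup(C\cap\beta)=\beta$. Limit ordinals are nonzero. For an infinite cardinal $\lambda$, a $\square_\lambda$-sequence is a sequence $\langle C_\alpha\mid\alpha<\lambda^+\rangle$ such that for every limit ordinal $\alpha<\lambda^+$: 1. $C_\alpha$ is a club in $\alpha$ with $\operatorname{otp}(C_\alpha)\le\lambda$; 2. if $\beta\in\operatorname{acc}(C_\alpha)$, then $C_\beta=C_\alpha\cap\beta$. The principle $\square_\lambda$ asserts that a $\square_\lambda$-sequence exists. The Ostaszewski square for $\lambda$ (denoted $\clubsuit$ inside $\square$, with subscript $\lambda$) asserts that there is a $\square_\lambda$-sequence $\langle C_\alpha\mid\alpha<\lambda^+\rangle$ that satisfies in addition: 3. for every sequence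 $\langle A_i\mid i<\lambda\rangle$ of unbounded subsets of $\lambda^+$, every limit ordinal $\theta<\lambda$ and every club $D$ in $\lambda^+$, there exists a limit ordinal $\alpha<\lambda^+$ such that $\operatorname{otp}(C_\alpha)=\theta$ and, for all $i<\theta$, (a) $C_\alpha(i+1)\in A_i$, and (b) $C_\alpha(i)<\beta<C_\alpha(i+1)$ for some $\beta\in D$. Let $\lambda$ be an infinite successor cardinal with $\lambda^{<\lambda}<\lambda^{\lambda}=\lambda^+$, where $\lambda^{<\lambda}=\sup\{\lambda^\mu\mid \mu<\lambda \text{ a cardinal}\}$. If $\square_\lambda$ holds, then the Ostaszewski square for $\lambda$ holds. -/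

import Mathlib

universe u

namespace OstSq

open Cardinal Ordinal Order

/-- `A` is a cofinal (equivalently, for limit `δ`, unbounded) subset of the ordinal `δ`. -/
def IsCofinalIn (A : Set Ordinal.{u}) (δ : Ordinal.{u}) : Prop :=
  A ⊆ Set.Iio δ ∧ ∀ β < δ, ∃ γ ∈ A, β ≤ γ

/-- `β` is an accumulation point of `C`, that is, `β` is nonzero and `sup (C ∩ β) = β`. -/
def IsAccOf (C : Set Ordinal.{u}) (β : Ordinal.{u}) : Prop :=
  β ≠ 0 ∧ sSup (C ∩ Set.Iio β) = β

/-- `C` is a club in the ordinal `δ`: a cofinal subset of `δ` which contains each of its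
accumulation points below `δ`. -/
def IsClubIn (C : Set Ordinal.{u}) (δ : Ordinal.{u}) : Prop :=
  IsCofinalIn C δ ∧ ∀ β < δ, IsAccOf C β → β ∈ C

/-- The set `acc(C)` of those elements of `C` that are accumulation points of `C`. -/
def acc (C : Set Ordinal.{u}) : Set Ordinal.{u} :=
  {β | β ∈ C ∧ IsAccOf C β}

/-- The order type of a set of ordinals. A set of ordinals in universe `u` is a type in universe
`u + 1`, so order types are compared with ordinals of universe `u` through `Ordinal.lift`. -/
noncomputable def otp (C : Set Ordinal.{u}) : Ordinal.{u + 1} :=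
  Ordinal.type (fun x y : C => x < y)

/-- `β` is the `i`-th element `C(i)` of `C`: the unique `β ∈ C` such that `C ∩ β` has
order type `i`. -/
def IsNth (C : Set Ordinal.{u}) (i β : Ordinal.{u}) : Prop :=
  β ∈ C ∧ otp (C ∩ Set.Iio β) = Ordinal.lift.{u + 1} i

/-- `⟨C α | α < λ⁺⟩` is a `□_λ`-sequence. Only the values of `C` at nonzero limit ordinals
below `λ⁺` are relevant. -/
def IsSquareSeq (lam : Cardinal.{u}) (C : Ordinal.{u} → Set Ordinal.{u}) : Prop :=
  ∀ α < (succ lam).ord, IsSuccLimit α →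
    IsClubIn (C α) α ∧ otp (C α) ≤ Ordinal.lift.{u + 1} lam.ord ∧
      ∀ β ∈ acc (C α), C β = C α ∩ Set.Iio β

/-- Jensen's principle `□_λ`. -/
def Square (lam : Cardinal.{u}) : Prop :=
  ∃ C : Ordinal.{u} → Set Ordinal.{u}, IsSquareSeq lam C

/-- The guessing clause of the Ostaszewski square: for every sequence `⟨A i | i < λ⟩` of unbounded
subsets of `λ⁺`, every nonzero limit `θ < λ` and every club `D` in `λ⁺` there is a limit `α < λ⁺`
such that `otp (C α) = θ` and, for all `i < θ`, `C α (i+1) ∈ A i` and some element of `D` lies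
strictly between `C α (i)` and `C α (i+1)`. -/
def Guesses (lam : Cardinal.{u}) (C : Ordinal.{u} → Set Ordinal.{u}) : Prop :=
  ∀ A : Ordinal.{u} → Set Ordinal.{u},
    (∀ i < lam.ord, IsCofinalIn (A i) (succ lam).ord) →
    ∀ θ < lam.ord, IsSuccLimit θ →
    ∀ D : Set Ordinal.{u}, IsClubIn D (succ lam).ord →
    ∃ α < (succ lam).ord, IsSuccLimit α ∧ otp (C α) = Ordinal.lift.{u + 1} θ ∧
      ∀ i < θ, ∃ γ γ' : Ordinal.{u}, IsNth (C α) i γ ∧ IsNth (C α) (succ i) γ' ∧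
        γ' ∈ A i ∧ ∃ β ∈ D, γ < β ∧ β < γ'

/-- The Ostaszewski square for `λ`: a single `□_λ`-sequence with the guessing clause. -/
def OstaszewskiSquare (lam : Cardinal.{u}) : Prop :=
  ∃ C : Ordinal.{u} → Set Ordinal.{u}, IsSquareSeq lam C ∧ Guesses lam C

end OstSq

namespace OstSq

open Cardinal Ordinal Order

/-! The proof has three stages. Club guessing (`exists_isSquareSeq_club_guessing`): replacing each
point of `C α` by the largest element of a club `D` not above it preserves the square axioms. If for
some `θ` no `D` made the result guess clubs at order type `θ`, a counterexample club could be
intersected in at each of `λ` stages. Maxima of a decreasing chain of clubs below a fixed ordinal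
stabilise, so by regularity some stage already agrees with the limit on a set of size `< λ`, and its
counterexample fails. From clubs to families `A i` (`exists_interval_guess`): for fixed `θ`, a rule
`Ψ` picks a point in each interval between consecutive elements of `C α`. The candidate rules are
indexed by `h : θ → λ`, so there are at most `λ` of them. If all failed, their counterexamples could
be handled simultaneously: `(λ⁺) ^ λ = λ⁺` lets one ordinal code a witness for every `h` and `i`,
and club guessing yields an `α` from which an `h` is read off whose rule decodes its own witnesses.
Gluing (`isSquareSeq_blockEnum`): rules for different `θ` must coexist in one coherent sequence. The
order type of `C α` decides: if it lies in `(ω ^ μ, ω ^ (μ + 1)]`, the first `ω ^ μ` points are cut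
off and the rule for `μ` is applied. Limit points of the remaining tail have order types in the same
interval, so coherence survives, and order type `ω ^ θ + θ` is turned into `θ`. -/

/-! ### Accumulation points and clubs in a regular cardinal. -/

theorem isAccOf_iff {C : Set Ordinal.{u}} {β : Ordinal.{u}} :
    IsAccOf C β ↔ β ≠ 0 ∧ ∀ ξ < β, ∃ d ∈ C, ξ < d ∧ d < β := by
  have hb : BddAbove (C ∩ Set.Iio β) := ⟨β, fun x hx => le_of_lt hx.2⟩
  refine and_congr_right fun h0 => ⟨fun h ξ hξ => ?_, fun h => le_antisymm ?_ ?_⟩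
  · by_contra! hc
    have : sSup (C ∩ Set.Iio β) ≤ ξ :=
      csSup_le' fun d hd => not_lt.1 fun hlt => (hc d hd.1 hlt).not_gt hd.2
    exact absurd hξ (not_lt.2 (h ▸ this))
  · exact csSup_le' fun x hx => le_of_lt hx.2
  · refine le_of_forall_lt fun ξ hξ => ?_
    obtain ⟨d, hd, h1, h2⟩ := h ξ hξ
    exact h1.trans_le (le_csSup hb ⟨hd, h2⟩)

theorem IsAccOf.mono {C D : Set Ordinal.{u}} {β : Ordinal.{u}} (h : IsAccOf C β) (hs : C ⊆ D) :
    IsAccOf D β := by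
  rw [isAccOf_iff] at h ⊢
  exact ⟨h.1, fun ξ hξ => let ⟨d, hd, h'⟩ := h.2 ξ hξ; ⟨d, hs hd, h'⟩⟩

theorem IsAccOf.isSuccLimit {C : Set Ordinal.{u}} {β : Ordinal.{u}} (h : IsAccOf C β) :
    IsSuccLimit β := by
  rw [isAccOf_iff] at h
  rw [Ordinal.isSuccLimit_iff]
  refine ⟨h.1, isSuccPrelimit_of_succ_lt fun ξ hξ => ?_⟩
  obtain ⟨d, -, h1, h2⟩ := h.2 ξ hξ
  exact (succ_le_of_lt h1).trans_lt h2

theorem IsCofinalIn.exists_gt {A : Set Ordinal.{u}} {δ ξ : Ordinal.{u}} (h : IsCofinalIn A δ)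
    (hδ : IsSuccLimit δ) (hξ : ξ < δ) : ∃ a ∈ A, ξ < a ∧ a < δ :=
  let ⟨a, ha, h1⟩ := h.2 _ (hδ.succ_lt hξ)
  ⟨a, ha, (lt_succ ξ).trans_le h1, h.1 ha⟩

theorem exists_bound {c : Cardinal.{u}} (hc : c.IsRegular) {ι : Type (u + 1)}
    (hι : #ι < Cardinal.lift.{u + 1} c) (f : ι → Ordinal.{u}) (hf : ∀ i, f i < c.ord) :
    ∃ b < c.ord, ∀ i, f i < b := by
  have h1 : ⨆ i, f i + 1 < c.ord := by
    refine lift_iSup_add_one_lt_of_lt_cof ?_ hf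
    rw [← lift_cof, hc.cof_ord, Cardinal.lift_id'.{u, u + 1}]
    exact hι
  refine ⟨_, h1, fun i => ?_⟩
  refine (lt_add_one (f i)).trans_le (le_ciSup (f := fun i => f i + 1) ⟨c.ord, ?_⟩ i)
  rintro _ ⟨j, rfl⟩
  exact ((Cardinal.isSuccLimit_ord hc.aleph0_le).succ_lt (hf j)).le

theorem mk_Iio_lt {c : Cardinal.{u}} {γ : Ordinal.{u}} (h : γ < c.ord) :
    #(Set.Iio γ) < Cardinal.lift.{u + 1} c := by
  rw [Cardinal.mk_Iio_ordinal, Cardinal.lift_lt]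
  exact Cardinal.lt_ord.1 h

/-- By regularity, all values of the `G i` on a bounded set lie below one bound; iterating such
bounds `ω` times and taking the supremum gives a closure point. -/
theorem isClubIn_closure_points {c : Cardinal.{u}} (hc : c.IsRegular) (hω : ℵ₀ < c)
    {ι : Type (u + 1)} (hι : #ι < Cardinal.lift.{u + 1} c) (G : ι → Ordinal.{u} → Ordinal.{u})
    (hG : ∀ i, ∀ γ < c.ord, G i γ < c.ord) :
    IsClubIn {β | β < c.ord ∧ ∀ γ < β, ∀ i, G i γ < β} c.ord := by
  have hlim := Cardinal.isSuccLimit_ord hc.aleph0_le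
  refine ⟨⟨fun x hx => hx.1, fun β₀ hβ₀ => ?_⟩, fun β hβ hacc => ⟨hβ, fun γ hγ i => ?_⟩⟩
  · have step : ∀ γ : Ordinal.{u}, ∃ b, γ < c.ord → b < c.ord ∧ γ < b ∧
        ∀ γ' < γ, ∀ i, G i γ' < b := by
      intro γ
      by_cases hγ : γ < c.ord
      · have hcard : #(ι × Set.Iio γ) < Cardinal.lift.{u + 1} c := by
          rw [mk_prod, Cardinal.lift_id, Cardinal.lift_id]
          exact mul_lt_of_lt (by simpa using hc.aleph0_le) hι (mk_Iio_lt hγ)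
        obtain ⟨b, hb, h⟩ := exists_bound hc hcard (fun p => G p.1 p.2)
          (fun p => hG _ _ (lt_trans p.2.2 hγ))
        exact ⟨max b (succ γ), fun _ => ⟨max_lt hb (hlim.succ_lt hγ),
          (lt_succ γ).trans_le (le_max_right _ _),
          fun γ' h' i => (h (i, ⟨γ', h'⟩)).trans_le (le_max_left _ _)⟩⟩
      · exact ⟨0, fun h => absurd h hγ⟩
    choose g hg using step
    have hb : ∀ n : ℕ, g^[n] β₀ < c.ord := by
      intro n
      induction n with
      | zero => exact hβ₀
      | succ n ih => rw [Function.iterate_succ_apply']; exact (hg _ ih).1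
    have hs : ∀ n : ℕ, g^[n] β₀ < g^[n + 1] β₀ := fun n => by
      rw [Function.iterate_succ_apply']; exact (hg _ (hb n)).2.1
    obtain ⟨b, hbc, hb'⟩ := exists_bound hc (ι := ULift.{u + 1} ℕ) (by simpa using hω)
      (fun n => g^[n.down] β₀) (fun n => hb _)
    have hbdd : BddAbove (Set.range fun n : ℕ => g^[n] β₀) :=
      ⟨b, by rintro _ ⟨n, rfl⟩; exact (hb' ⟨n⟩).le⟩
    have hle : ∀ n : ℕ, g^[n] β₀ ≤ ⨆ n : ℕ, g^[n] β₀ := fun n => le_ciSup hbdd n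
    refine ⟨⨆ n : ℕ, g^[n] β₀, ⟨(ciSup_le' fun n => (hb' ⟨n⟩).le).trans_lt hbc, ?_⟩, hle 0⟩
    intro γ hγ i
    obtain ⟨n, hn⟩ := exists_lt_of_lt_ciSup' hγ
    refine lt_of_lt_of_le ?_ (hle (n + 1))
    rw [Function.iterate_succ_apply']
    exact (hg _ (hb n)).2.2 γ hn i
  · obtain ⟨d, hd, h1, h2⟩ := (isAccOf_iff.1 hacc).2 γ hγ
    exact (hd.2 γ h1 i).trans h2

theorem isClubIn_iInter {c : Cardinal.{u}} (hc : c.IsRegular) (hω : ℵ₀ < c)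
    {ι : Type (u + 1)} (hι : #ι < Cardinal.lift.{u + 1} c) (D : ι → Set Ordinal.{u})
    (hD : ∀ i, IsClubIn (D i) c.ord) :
    IsClubIn {β | β < c.ord ∧ ∀ i, β ∈ D i} c.ord := by
  have hlim := Cardinal.isSuccLimit_ord hc.aleph0_le
  refine ⟨⟨fun x hx => hx.1, fun β₀ hβ₀ => ?_⟩, fun β hβ hacc => ⟨hβ, fun i => ?_⟩⟩
  · have : ∀ i (γ : Ordinal.{u}), ∃ d, γ < c.ord → d ∈ D i ∧ γ < d ∧ d < c.ord := by
      intro i γ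
      by_cases hγ : γ < c.ord
      · obtain ⟨d, h⟩ := (hD i).1.exists_gt hlim hγ
        exact ⟨d, fun _ => h⟩
      · exact ⟨0, fun h => absurd h hγ⟩
    choose G hG using this
    -- The `1` keeps the closure point nonzero, as an accumulation point must be.
    obtain ⟨β, ⟨hβ, hcl⟩, hle⟩ := (isClubIn_closure_points hc hω hι G
      (fun i γ h => (hG i γ h).2.2)).1.2 (max 1 β₀) (max_lt (by
        simpa using hlim.succ_lt hc.ord_pos) hβ₀)
    refine ⟨β, ⟨hβ, fun i => (hD i).2 β hβ (isAccOf_iff.2 ⟨?_, fun ξ hξ => ?_⟩)⟩,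
      (le_max_right _ _).trans hle⟩
    · exact (zero_lt_one.trans_le ((le_max_left _ _).trans hle)).ne'
    · have := hG i ξ (hξ.trans hβ)
      exact ⟨G i ξ, this.1, this.2.1, hcl ξ hξ i⟩
  · exact (hD i).2 β hβ (hacc.mono fun x hx => hx.2 i)

theorem IsClubIn.exists_isGreatest {D : Set Ordinal.{u}} {δ γ d : Ordinal.{u}}
    (hD : IsClubIn D δ) (hγ : γ < δ) (hd : d ∈ D) (hdγ : d ≤ γ) :
    ∃ v, IsGreatest (D ∩ Set.Iic γ) v := by
  have hb : BddAbove (D ∩ Set.Iic γ) := ⟨γ, fun x hx => hx.2⟩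
  have hne : (D ∩ Set.Iic γ).Nonempty := ⟨d, hd, hdγ⟩
  have hlub := isLUB_csSup hne hb
  refine ⟨_, ?_, hlub.1⟩
  by_contra hv
  have hle : sSup (D ∩ Set.Iic γ) ≤ γ := csSup_le' fun x hx => hx.2
  have hlt : ∀ x ∈ D ∩ Set.Iic γ, x < sSup (D ∩ Set.Iic γ) := fun x hx =>
    lt_of_le_of_ne (hlub.1 hx) fun h => hv (h ▸ hx)
  refine hv ⟨hD.2 _ (hle.trans_lt hγ) (isAccOf_iff.2 ⟨?_, fun ξ hξ => ?_⟩), hle⟩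
  · exact ((zero_le (a := d)).trans_lt (hlt d ⟨hd, hdγ⟩)).ne'
  · obtain ⟨x, hx, h⟩ := exists_lt_of_lt_csSup hne hξ
    exact ⟨x, hx.1, h, hlt x hx⟩


/-! ### Order types, and dropping a square sequence onto a club. -/

theorem otp_le_of_strictMono {C C' : Set Ordinal.{u}} (f : C → C') (hf : StrictMono f) :
    otp C ≤ otp C' :=
  Ordinal.type_le_iff'.2 ⟨RelEmbedding.ofMonotone f fun _ _ h => hf h⟩

theorem otp_mono {C C' : Set Ordinal.{u}} (h : C ⊆ C') : otp C ≤ otp C' :=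
  otp_le_of_strictMono (fun x => ⟨x, h x.2⟩) fun _ _ h => h

theorem card_otp (C : Set Ordinal.{u}) : (otp C).card = #C :=
  Ordinal.card_type _

open Classical in
/-- The sequence obtained from `C` by replacing, at accumulation points of `D`, each ordinal by the
largest element of `D` which does not exceed it. -/
noncomputable def dropSeq (D : Set Ordinal.{u}) (C : Ordinal.{u} → Set Ordinal.{u})
    (α : Ordinal.{u}) : Set Ordinal.{u} :=
  if IsAccOf D α then {v | ∃ γ ∈ C α, IsGreatest (D ∩ Set.Iic γ) v}
  else C α \ Set.Iic (sSup (D ∩ Set.Iio α))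

theorem mem_dropSeq {D : Set Ordinal.{u}} {C : Ordinal.{u} → Set Ordinal.{u}} {α v : Ordinal.{u}}
    (h : IsAccOf D α) : v ∈ dropSeq D C α ↔ ∃ γ ∈ C α, IsGreatest (D ∩ Set.Iic γ) v := by
  rw [dropSeq, if_pos h]; rfl

theorem dropSeq_subset {D : Set Ordinal.{u}} {C : Ordinal.{u} → Set Ordinal.{u}} {α : Ordinal.{u}}
    (h : IsAccOf D α) : dropSeq D C α ⊆ D := fun v hv => by
  obtain ⟨γ, -, h'⟩ := (mem_dropSeq h).1 hv
  exact h'.1.1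

/-- Between two dropped values `v < v'` lies the point of `C α` that drops to `v`: had it reached
`v'`, it would drop to at least `v'`. -/
theorem isAccOf_of_dropSeq {D : Set Ordinal.{u}} {C : Ordinal.{u} → Set Ordinal.{u}}
    {α β : Ordinal.{u}} (h : IsAccOf D α) (hβ : IsAccOf (dropSeq D C α) β) :
    IsAccOf D β ∧ IsAccOf (C α) β := by
  refine ⟨hβ.mono (dropSeq_subset h), ?_⟩
  rw [isAccOf_iff] at hβ ⊢
  refine ⟨hβ.1, fun ξ hξ => ?_⟩
  obtain ⟨v, hv, h1, h2⟩ := hβ.2 ξ hξ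
  obtain ⟨v', hv', h1', h2'⟩ := hβ.2 v h2
  obtain ⟨γ, hγ, hg⟩ := (mem_dropSeq h).1 hv
  refine ⟨γ, hγ, h1.trans_le hg.1.2, lt_trans (not_le.1 fun hle => ?_) h2'⟩
  exact absurd (hg.2 ⟨dropSeq_subset h hv', hle⟩) (not_le.2 h1')

theorem otp_dropSeq_le (D : Set Ordinal.{u}) (C : Ordinal.{u} → Set Ordinal.{u})
    (α : Ordinal.{u}) : otp (dropSeq D C α) ≤ otp (C α) := by
  by_cases h : IsAccOf D α
  · have : ∀ v : dropSeq D C α, ∃ γ : C α, IsGreatest (D ∩ Set.Iic γ.1) v.1 := fun v =>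
      let ⟨γ, hγ, h'⟩ := (mem_dropSeq h).1 v.2
      ⟨⟨γ, hγ⟩, h'⟩
    choose f hf using this
    refine otp_le_of_strictMono f fun v w hvw => not_le.1 fun hle => ?_
    exact absurd ((hf v).2 ⟨(hf w).1.1, le_trans (Set.mem_Iic.1 (hf w).1.2) hle⟩) (not_le.2 hvw)
  · rw [dropSeq, if_neg h]
    exact otp_mono Set.sdiff_subset

theorem dropSeq_inter_Iio {D : Set Ordinal.{u}} {C : Ordinal.{u} → Set Ordinal.{u}}
    {α β : Ordinal.{u}} (hα : IsAccOf D α) (hβ : IsAccOf D β) (hβD : β ∈ D)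
    (hC : C β = C α ∩ Set.Iio β) : dropSeq D C β = dropSeq D C α ∩ Set.Iio β := by
  ext v
  rw [Set.mem_inter_iff, mem_dropSeq hα, mem_dropSeq hβ, hC]
  constructor
  · rintro ⟨γ, ⟨hγ, hlt⟩, hg⟩
    exact ⟨⟨γ, hγ, hg⟩, lt_of_le_of_lt (Set.mem_Iic.1 hg.1.2) hlt⟩
  · rintro ⟨⟨γ, hγ, hg⟩, hv⟩
    refine ⟨γ, ⟨hγ, Set.mem_Iio.2 (not_le.1 fun hle => ?_)⟩, hg⟩
    exact absurd (hg.2 ⟨hβD, hle⟩) (not_le.2 hv)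

theorem isSquareSeq_dropSeq {lam : Cardinal.{u}} {D : Set Ordinal.{u}}
    {C : Ordinal.{u} → Set Ordinal.{u}} (hD : IsClubIn D (succ lam).ord)
    (hC : IsSquareSeq lam C) : IsSquareSeq lam (dropSeq D C) := by
  intro α hα hlim
  obtain ⟨hclub, hotp, hcoh⟩ := hC α hα hlim
  refine ⟨?_, (otp_dropSeq_le D C α).trans hotp, ?_⟩
  · by_cases h : IsAccOf D α
    · refine ⟨⟨fun v hv => ?_, fun ξ hξ => ?_⟩, fun β hβ hacc => ?_⟩
      · obtain ⟨γ, hγ, hg⟩ := (mem_dropSeq h).1 hv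
        exact lt_of_le_of_lt (Set.mem_Iic.1 hg.1.2) (Set.mem_Iio.1 (hclub.1.1 hγ))
      · obtain ⟨d, hd, h1, h2⟩ := (isAccOf_iff.1 h).2 ξ hξ
        obtain ⟨γ, hγ, hle⟩ := hclub.1.2 d h2
        obtain ⟨v, hv⟩ := hD.exists_isGreatest ((hclub.1.1 hγ).trans hα) hd hle
        exact ⟨v, (mem_dropSeq h).2 ⟨γ, hγ, hv⟩, h1.le.trans (hv.2 ⟨hd, hle⟩)⟩
      · obtain ⟨h1, h2⟩ := isAccOf_of_dropSeq h hacc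
        exact (mem_dropSeq h).2 ⟨β, hclub.2 β hβ h2, ⟨hD.2 β (hβ.trans hα) h1, Set.mem_Iic.2 le_rfl⟩,
          fun x hx => hx.2⟩
    · have hlt : sSup (D ∩ Set.Iio α) < α :=
        lt_of_le_of_ne (csSup_le' fun x hx => le_of_lt hx.2) fun h' => h ⟨hlim.ne_bot, h'⟩
      rw [dropSeq, if_neg h]
      refine ⟨⟨fun v hv => hclub.1.1 hv.1, fun ξ hξ => ?_⟩, fun β hβ hacc => ⟨?_, ?_⟩⟩
      · obtain ⟨a, ha, h1, h2⟩ := hclub.1.exists_gt hlim (max_lt hξ hlt)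
        exact ⟨a, ⟨ha, not_le.2 ((le_max_right _ _).trans_lt h1)⟩,
          ((le_max_left _ _).trans_lt h1).le⟩
      · exact hclub.2 β hβ (hacc.mono Set.sdiff_subset)
      · obtain ⟨d, hd, h1, h2⟩ := (isAccOf_iff.1 hacc).2 0
          (pos_iff_ne_zero.2 (isAccOf_iff.1 hacc).1)
        exact not_le.2 ((not_le.1 hd.2).trans h2)
  · rintro β ⟨hβ, hacc⟩
    by_cases h : IsAccOf D α
    · obtain ⟨h1, h2⟩ := isAccOf_of_dropSeq h hacc
      obtain ⟨γ, hγ, hg⟩ := (mem_dropSeq h).1 hβ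
      have hβα : β < α := lt_of_le_of_lt (Set.mem_Iic.1 hg.1.2) (Set.mem_Iio.1 (hclub.1.1 hγ))
      exact dropSeq_inter_Iio h h1 hg.1.1 (hcoh β ⟨hclub.2 β hβα h2, h2⟩)
    · rw [dropSeq, if_neg h] at hβ hacc
      have hb : BddAbove (D ∩ Set.Iio α) := ⟨α, fun x hx => le_of_lt hx.2⟩
      have hlt : sSup (D ∩ Set.Iio α) < β := not_le.1 hβ.2
      -- In the tail case `D` has no elements in `[β, α)`, so `α` and `β` cut off at the same
      -- supremum.
      have hsame : D ∩ Set.Iio β = D ∩ Set.Iio α := by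
        refine Set.Subset.antisymm
          (Set.inter_subset_inter_right _ (Set.Iio_subset_Iio (le_of_lt (hclub.1.1 hβ.1)))) ?_
        exact fun x hx => ⟨hx.1, (le_csSup hb hx).trans_lt hlt⟩
      have hna : ¬ IsAccOf D β := fun h' => absurd h'.2 (by rw [hsame]; exact hlt.ne)
      rw [dropSeq, if_neg hna, dropSeq, if_neg h, hsame, hcoh β ⟨hβ.1, hacc.mono Set.sdiff_subset⟩]
      ext x
      simp only [Set.mem_sdiff, Set.mem_inter_iff]
      tauto


/-! ### Increasing enumerations and coherence in terms of them. -/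

/-- `e` enumerates `C` increasingly in order type `o`. -/
structure IsEnum (C : Set Ordinal.{u}) (o : Ordinal.{u}) (e : Ordinal.{u} → Ordinal.{u}) : Prop where
  lt : ∀ i j, i < j → j < o → e i < e j
  mem : ∀ i < o, e i ∈ C
  surj : ∀ x ∈ C, ∃ i < o, e i = x

namespace IsEnum

variable {C : Set Ordinal.{u}} {o o' : Ordinal.{u}} {e e' : Ordinal.{u} → Ordinal.{u}}

theorem lt_iff (h : IsEnum C o e) {i j : Ordinal.{u}} (hi : i < o) (hj : j < o) :
    e i < e j ↔ i < j := by
  refine ⟨fun hlt => not_le.1 fun hle => ?_, fun hlt => h.lt i j hlt hj⟩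
  rcases hle.eq_or_lt with rfl | h'
  · exact lt_irrefl _ hlt
  · exact lt_asymm hlt (h.lt j i h' hi)

theorem le_iff (h : IsEnum C o e) {i j : Ordinal.{u}} (hi : i < o) (hj : j < o) :
    e i ≤ e j ↔ i ≤ j := by
  rw [← not_lt, h.lt_iff hj hi, not_lt]

theorem otp_eq (h : IsEnum C o e) : otp C = Ordinal.lift.{u + 1} o := by
  rw [← Ordinal.type_lt_Iio]
  symm
  let f : Set.Iio o → C := fun i => ⟨e i, h.mem i i.2⟩
  have hf : StrictMono f := fun i j hij => h.lt i j hij j.2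
  have hs : Function.Surjective f := fun x =>
    let ⟨i, hi, hx⟩ := h.surj x x.2
    ⟨⟨i, hi⟩, Subtype.ext hx⟩
  exact (StrictMono.orderIsoOfSurjective f hf hs).toRelIsoLT.ordinalType_congr

theorem inter_Iio (h : IsEnum C o e) {i : Ordinal.{u}} (hi : i < o) :
    IsEnum (C ∩ Set.Iio (e i)) i e where
  lt := fun j k hjk hk => h.lt j k hjk (hk.trans hi)
  mem := fun j hj => ⟨h.mem j (hj.trans hi), h.lt j i hj hi⟩
  surj := fun x hx => by
    obtain ⟨j, hj, rfl⟩ := h.surj x hx.1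
    exact ⟨j, (h.lt_iff hj hi).1 hx.2, rfl⟩

theorem isNth (h : IsEnum C o e) {i : Ordinal.{u}} (hi : i < o) : IsNth C i (e i) :=
  ⟨h.mem i hi, (h.inter_Iio hi).otp_eq⟩

theorem unique (h : IsEnum C o e) (h' : IsEnum C o' e') : o = o' ∧ ∀ i < o, e i = e' i := by
  refine ⟨Ordinal.lift_inj.1 (h.otp_eq.symm.trans h'.otp_eq), fun i hi => ?_⟩
  obtain ⟨j, hj, hx⟩ := h'.surj (e i) (h.mem i hi)
  have h1 := (h.inter_Iio hi).otp_eq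
  have h2 := (h'.inter_Iio hj).otp_eq
  rw [hx, h1, Ordinal.lift_inj] at h2
  subst h2
  exact hx.symm

theorem isSuccLimit_of_isAccOf (h : IsEnum C o e) {j : Ordinal.{u}} (hj : j < o)
    (hacc : IsAccOf C (e j)) : IsSuccLimit j := by
  rw [isAccOf_iff] at hacc
  rw [Ordinal.isSuccLimit_iff]
  refine ⟨fun h0 => ?_, isSuccPrelimit_of_succ_lt fun k hk => ?_⟩
  · obtain ⟨d, hd, -, h2⟩ := hacc.2 0 (pos_iff_ne_zero.2 hacc.1)
    obtain ⟨i, hi, rfl⟩ := h.surj d hd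
    have := (h.lt_iff hi hj).1 h2
    rw [h0] at this
    exact not_lt_zero this
  · obtain ⟨d, hd, h1, h2⟩ := hacc.2 (e k) (h.lt k j hk hj)
    obtain ⟨i, hi, rfl⟩ := h.surj d hd
    exact (succ_le_of_lt ((h.lt_iff (hk.trans hj) hi).1 h1)).trans_lt ((h.lt_iff hi hj).1 h2)

theorem isSuccLimit_length (h : IsEnum C o e) {α : Ordinal.{u}} (hα : IsSuccLimit α)
    (hC : IsCofinalIn C α) : IsSuccLimit o := by
  rw [Ordinal.isSuccLimit_iff]
  refine ⟨fun h0 => ?_, isSuccPrelimit_of_succ_lt fun k hk => ?_⟩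
  · obtain ⟨d, hd, -⟩ := hC.2 0 hα.bot_lt
    obtain ⟨i, hi, -⟩ := h.surj d hd
    rw [h0] at hi
    exact not_lt_zero hi
  · obtain ⟨d, hd, h1, -⟩ := hC.exists_gt hα (hC.1 (h.mem k hk))
    obtain ⟨i, hi, rfl⟩ := h.surj d hd
    exact (succ_le_of_lt ((h.lt_iff hk hi).1 h1)).trans_lt hi

/-- Enumerations of clubs are continuous: a supremum of the earlier values strictly below `e j`
would be an element of `C` lying between all of them and `e j`. -/
theorem isAccOf_of_isSuccLimit (h : IsEnum C o e) {α j : Ordinal.{u}} (hC : IsClubIn C α)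
    (hj : j < o) (hlim : IsSuccLimit j) : IsAccOf C (e j) := by
  have hjα : e j < α := hC.1.1 (h.mem j hj)
  by_contra hna
  have hb : BddAbove (C ∩ Set.Iio (e j)) := ⟨e j, fun x hx => le_of_lt hx.2⟩
  have hpos : e j ≠ 0 := fun h0 => by
    have := h.lt 0 j hlim.bot_lt hj
    rw [h0] at this
    exact not_lt_zero this
  set β := sSup (C ∩ Set.Iio (e j)) with hβ
  have hβlt : β < e j :=
    lt_of_le_of_ne (csSup_le' fun x hx => le_of_lt hx.2) fun h' => hna ⟨hpos, h'⟩
  have hlt : ∀ i < j, e i < β := fun i hi =>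
    (h.lt i (succ i) (lt_succ i) ((hlim.succ_lt hi).trans hj)).trans_le
      (le_csSup hb ⟨h.mem _ ((hlim.succ_lt hi).trans hj), h.lt _ _ (hlim.succ_lt hi) hj⟩)
  have hβC : β ∈ C := by
    refine hC.2 β (hβlt.trans hjα) (isAccOf_iff.2 ⟨?_, fun ξ hξ => ?_⟩)
    · exact ((zero_le (a := e 0)).trans_lt (hlt 0 hlim.bot_lt)).ne'
    · have hne : (C ∩ Set.Iio (e j)).Nonempty :=
        ⟨e 0, h.mem 0 (hlim.bot_lt.trans hj), h.lt 0 j hlim.bot_lt hj⟩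
      obtain ⟨x, hx, hξx⟩ := exists_lt_of_lt_csSup hne hξ
      obtain ⟨i, hi, rfl⟩ := h.surj x hx.1
      exact ⟨e i, hx.1, hξx, hlt i ((h.lt_iff hi hj).1 hx.2)⟩
  obtain ⟨i, hi, hx⟩ := h.surj β hβC
  have hij : i < j := (h.lt_iff hi hj).1 (hx ▸ hβlt)
  exact (hlt i hij).ne hx

theorem exists_gt_of_isSuccLimit (h : IsEnum C o e) {α j ξ : Ordinal.{u}} (hC : IsClubIn C α)
    (hj : j < o) (hlim : IsSuccLimit j) (hξ : ξ < e j) : ∃ i < j, ξ < e i := by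
  obtain ⟨d, hd, h1, h2⟩ := (isAccOf_iff.1 (h.isAccOf_of_isSuccLimit hC hj hlim)).2 ξ hξ
  obtain ⟨i, hi, rfl⟩ := h.surj d hd
  exact ⟨i, (h.lt_iff hi hj).1 h2, h1⟩

end IsEnum

theorem exists_isEnum {C : Set Ordinal.{u}} {b : Ordinal.{u}}
    (h : otp C ≤ Ordinal.lift.{u + 1} b) : ∃ o ≤ b, ∃ e, IsEnum C o e := by
  obtain ⟨o, ho, hoC⟩ := Ordinal.le_lift_iff.1 h
  rw [← Ordinal.type_lt_Iio] at hoC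
  obtain ⟨f⟩ := Ordinal.type_eq.1 hoC
  refine ⟨o, ho, fun i => if hi : i ∈ Set.Iio o then f ⟨i, hi⟩ else 0, ⟨fun i j hij hj => ?_,
    fun i hi => ?_, fun x hx => ?_⟩⟩
  · rw [dif_pos (Set.mem_Iio.2 hj), dif_pos (Set.mem_Iio.2 (hij.trans hj))]
    exact f.map_rel_iff.2 (show (⟨i, _⟩ : Set.Iio o) < ⟨j, _⟩ from hij)
  · rw [dif_pos (Set.mem_Iio.2 hi)]
    exact (f ⟨i, hi⟩).2
  · obtain ⟨i, hi⟩ := f.surjective ⟨x, hx⟩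
    refine ⟨i, i.2, ?_⟩
    rw [dif_pos i.2]
    exact congrArg Subtype.val hi

/-- `o` and `e` give the order types and the increasing enumerations of the clubs `C α`. -/
def EnumeratesSeq (lam : Cardinal.{u}) (C : Ordinal.{u} → Set Ordinal.{u})
    (o : Ordinal.{u} → Ordinal.{u}) (e : Ordinal.{u} → Ordinal.{u} → Ordinal.{u}) : Prop :=
  ∀ α < (succ lam).ord, IsSuccLimit α → o α ≤ lam.ord ∧ IsSuccLimit (o α) ∧
    IsEnum (C α) (o α) (e α)

theorem IsSquareSeq.exists_enumeratesSeq {lam : Cardinal.{u}} {C : Ordinal.{u} → Set Ordinal.{u}}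
    (hC : IsSquareSeq lam C) : ∃ o e, EnumeratesSeq lam C o e := by
  have : ∀ α : Ordinal.{u}, ∃ o e, α < (succ lam).ord → IsSuccLimit α → o ≤ lam.ord ∧
      IsSuccLimit o ∧ IsEnum (C α) o e := by
    intro α
    by_cases h : α < (succ lam).ord ∧ IsSuccLimit α
    · obtain ⟨h1, h2, -⟩ := hC α h.1 h.2
      obtain ⟨o, ho, e, he⟩ := exists_isEnum h2
      exact ⟨o, e, fun _ _ => ⟨ho, he.isSuccLimit_length h.2 h1.1, he⟩⟩
    · exact ⟨0, id, fun h1 h2 => absurd ⟨h1, h2⟩ h⟩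
  choose o e h using this
  exact ⟨o, e, h⟩

theorem EnumeratesSeq.coherent {lam : Cardinal.{u}} {C : Ordinal.{u} → Set Ordinal.{u}}
    {o : Ordinal.{u} → Ordinal.{u}} {e : Ordinal.{u} → Ordinal.{u} → Ordinal.{u}}
    (he : EnumeratesSeq lam C o e) (hC : IsSquareSeq lam C) {α j : Ordinal.{u}}
    (hα : α < (succ lam).ord) (hlim : IsSuccLimit α) (hj : j < o α) (hjl : IsSuccLimit j) :
    IsAccOf (C α) (e α j) ∧ e α j < α ∧ C (e α j) = C α ∩ Set.Iio (e α j) ∧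
      o (e α j) = j ∧ ∀ i < j, e (e α j) i = e α i := by
  obtain ⟨-, -, hE⟩ := he α hα hlim
  obtain ⟨hclub, -, hcoh⟩ := hC α hα hlim
  have hacc := hE.isAccOf_of_isSuccLimit hclub hj hjl
  have hlt : e α j < α := hclub.1.1 (hE.mem j hj)
  have heq := hcoh _ ⟨hE.mem j hj, hacc⟩
  obtain ⟨-, -, hE'⟩ := he _ (hlt.trans hα) hacc.isSuccLimit
  have hE2 := hE.inter_Iio hj
  rw [← heq] at hE2
  obtain ⟨h1, h2⟩ := hE2.unique hE'
  exact ⟨hacc, hlt, heq, h1.symm, fun i hi => (h2 i hi).symm⟩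

theorem isEnum_image {o : Ordinal.{u}} {e : Ordinal.{u} → Ordinal.{u}}
    (h : ∀ i j, i < j → j < o → e i < e j) : IsEnum (e '' Set.Iio o) o e where
  lt := h
  mem := fun i hi => ⟨i, hi, rfl⟩
  surj := fun _ ⟨i, hi, hx⟩ => ⟨i, hi, hx⟩

theorem isSquareSeq_of_enum {lam : Cardinal.{u}} {o : Ordinal.{u} → Ordinal.{u}}
    {e : Ordinal.{u} → Ordinal.{u} → Ordinal.{u}}
    (h : ∀ α < (succ lam).ord, IsSuccLimit α → o α ≤ lam.ord ∧
      (∀ i j, i < j → j < o α → e α i < e α j) ∧ (∀ i < o α, e α i < α) ∧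
      (∀ ξ < α, ∃ i < o α, ξ ≤ e α i) ∧
      ∀ j < o α, IsSuccLimit j → (∀ ξ < e α j, ∃ i < j, ξ < e α i) ∧ o (e α j) = j ∧
        ∀ i < j, e (e α j) i = e α i) :
    IsSquareSeq lam fun α => e α '' Set.Iio (o α) := by
  intro α hα hlim
  obtain ⟨ho, hmono, hlt, hcof, hj⟩ := h α hα hlim
  have hE := isEnum_image hmono
  refine ⟨⟨⟨?_, fun ξ hξ => ?_⟩, fun β hβ hacc => ?_⟩, ?_, ?_⟩
  · rintro _ ⟨i, hi, rfl⟩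
    exact hlt i hi
  · obtain ⟨i, hi, hle⟩ := hcof ξ hξ
    exact ⟨e α i, ⟨i, hi, rfl⟩, hle⟩
  · have hex : ∃ i, i < o α ∧ β ≤ e α i := hcof β hβ
    obtain ⟨j, ⟨hjo, hle⟩, hmin⟩ := WellFounded.has_min (wellFounded_lt (α := Ordinal.{u}))
      {i | i < o α ∧ β ≤ e α i} hex
    have hbelow : ∀ i < j, e α i < β := fun i hi =>
      not_le.1 fun hle' => hmin i ⟨hi.trans hjo, hle'⟩ hi
    have hup : ∀ d ∈ e α '' Set.Iio (o α), d < β → ∃ i < j, d = e α i := by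
      rintro _ ⟨i, hi, rfl⟩ hd
      exact ⟨i, (hE.lt_iff hi hjo).1 (hd.trans_le hle), rfl⟩
    rw [isAccOf_iff] at hacc
    have hjl : IsSuccLimit j := by
      rw [Ordinal.isSuccLimit_iff]
      refine ⟨fun h0 => ?_, isSuccPrelimit_of_succ_lt fun k hk => ?_⟩
      · obtain ⟨d, hd, -, h2⟩ := hacc.2 0 (pos_iff_ne_zero.2 hacc.1)
        obtain ⟨i, hi, -⟩ := hup d hd h2
        rw [h0] at hi
        exact not_lt_zero hi
      · obtain ⟨d, hd, h1, h2⟩ := hacc.2 (e α k) (hbelow k hk)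
        obtain ⟨i, hi, rfl⟩ := hup d hd h2
        exact (succ_le_of_lt ((hE.lt_iff (hk.trans hjo) (hi.trans hjo)).1 h1)).trans_lt hi
    rcases hle.eq_or_lt with h' | h'
    · exact ⟨j, hjo, h'.symm⟩
    · obtain ⟨i, hi, h2⟩ := (hj j hjo hjl).1 β h'
      exact absurd h2 (hbelow i hi).not_gt
  · rw [hE.otp_eq]
    exact Ordinal.lift_le.2 ho
  · rintro _ ⟨⟨j, hjo, rfl⟩, hacc⟩
    have hjl := hE.isSuccLimit_of_isAccOf hjo hacc
    obtain ⟨-, h1, h2⟩ := hj j hjo hjl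
    ext x
    simp only [h1, Set.mem_inter_iff, Set.mem_image, Set.mem_Iio]
    constructor
    · rintro ⟨i, hi, rfl⟩
      rw [h2 i hi]
      exact ⟨⟨i, hi.trans hjo, rfl⟩, hmono i j hi hjo⟩
    · rintro ⟨⟨i, hi, rfl⟩, hlt'⟩
      have := (hE.lt_iff hi hjo).1 hlt'
      exact ⟨i, this, h2 i this⟩


/-! ### Club guessing along a square sequence. -/

/-- The sequence `dropSeq D C` guesses clubs at points of order type `θ`. -/
def DropGuesses (lam : Cardinal.{u}) (C : Ordinal.{u} → Set Ordinal.{u}) (D : Set Ordinal.{u})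
    (θ : Ordinal.{u}) : Prop :=
  ∀ E : Set Ordinal.{u}, IsClubIn E (succ lam).ord → ∃ β < (succ lam).ord, IsAccOf D β ∧
    otp (dropSeq D C β) = Ordinal.lift.{u + 1} θ ∧ dropSeq D C β ⊆ E

theorem IsClubIn.exists_isEnum_ord {c : Cardinal.{u}} (hc : c.IsRegular) {D : Set Ordinal.{u}}
    (hD : IsClubIn D c.ord) : ∃ e, IsEnum D c.ord e := by
  have hle : otp D ≤ Ordinal.lift.{u + 1} c.ord := by
    rw [← Ordinal.type_lt_Iio]
    exact otp_mono hD.1.1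
  obtain ⟨o, ho, e, he⟩ := exists_isEnum hle
  rcases ho.eq_or_lt with rfl | hlt
  · exact ⟨e, he⟩
  · obtain ⟨b, hb, h⟩ := exists_bound hc (mk_Iio_lt hlt) (fun i => e i)
      (fun i => hD.1.1 (he.mem i i.2))
    obtain ⟨d, hd, hbd⟩ := hD.1.2 b hb
    obtain ⟨i, hi, rfl⟩ := he.surj d hd
    exact absurd hbd (not_le.2 (h ⟨i, hi⟩))

/-- The `λ`-th point of `D` has cofinality `λ`, so a cofinal subset of it cannot have order type at
most `θ < λ`. -/
theorem exists_lt_otp_dropSeq {lam : Cardinal.{u}} (hreg : lam.IsRegular)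
    {C : Ordinal.{u} → Set Ordinal.{u}} (hC : IsSquareSeq lam C) {D : Set Ordinal.{u}}
    (hD : IsClubIn D (succ lam).ord) {θ : Ordinal.{u}} (hθ : θ < lam.ord) :
    ∃ α < (succ lam).ord, IsAccOf D α ∧ Ordinal.lift.{u + 1} θ < otp (dropSeq D C α) := by
  obtain ⟨e, he⟩ := hD.exists_isEnum_ord (isRegular_succ hreg.aleph0_le)
  have hlam : lam.ord < (succ lam).ord := Cardinal.ord_lt_ord.2 (lt_succ lam)
  have hlim := Cardinal.isSuccLimit_ord hreg.aleph0_le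
  have hα : e lam.ord < (succ lam).ord := hD.1.1 (he.mem _ hlam)
  have hacc := he.isAccOf_of_isSuccLimit hD hlam hlim
  refine ⟨_, hα, hacc, not_le.1 fun hle => ?_⟩
  obtain ⟨⟨hsub, hcof⟩, -⟩ := (isSquareSeq_dropSeq hD hC _ hα hacc.isSuccLimit).1
  have hcard : #(dropSeq D C (e lam.ord)) < Cardinal.lift.{u + 1} lam := by
    rw [← card_otp]
    refine (Ordinal.card_le_card hle).trans_lt ?_
    rw [← Ordinal.lift_card, Cardinal.lift_lt]
    exact Cardinal.lt_ord.1 hθ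
  have hex : ∀ v : dropSeq D C (e lam.ord), ∃ i < lam.ord, v.1 < e i := fun v =>
    he.exists_gt_of_isSuccLimit hD hlam hlim (hsub v.2)
  choose i hi hv using hex
  obtain ⟨b, hb, h⟩ := exists_bound hreg hcard i hi
  obtain ⟨v, hvD, hbv⟩ := hcof (e b) (he.lt _ _ hb hlam)
  exact absurd (hbv.trans_lt (hv ⟨v, hvD⟩)) (not_lt.2 (he.lt _ _ (h ⟨v, hvD⟩) (hb.trans hlam)).le)

/-- The maxima of `D i` up to `γ` weakly decrease with `i`, hence are eventually constant by
well-foundedness; the constant value lies in every `D i`. -/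
theorem exists_stable_isGreatest {δ κ γ : Ordinal.{u}} (hκ : 0 < κ) (D : Ordinal.{u} → Set Ordinal.{u})
    (hD : ∀ i < κ, IsClubIn (D i) δ) (hanti : ∀ i j, i ≤ j → D j ⊆ D i) (hγ : γ < δ) :
    ∃ i₀ < κ, ∀ i < κ, i₀ ≤ i → ∀ v, IsGreatest (D i ∩ Set.Iic γ) v ↔
      IsGreatest ({x | x < δ ∧ ∀ i : Set.Iio κ, x ∈ D i} ∩ Set.Iic γ) v := by
  by_cases hne : ∀ i < κ, (D i ∩ Set.Iic γ).Nonempty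
  · have hex : ∀ i : Set.Iio κ, ∃ v, IsGreatest (D i ∩ Set.Iic γ) v := fun i =>
      let ⟨d, hd, hdγ⟩ := hne i i.2
      (hD i i.2).exists_isGreatest hγ hd hdγ
    choose w hw using hex
    have : Nonempty (Set.Iio κ) := ⟨⟨0, hκ⟩⟩
    obtain ⟨_, ⟨i₀, rfl⟩, hmin⟩ := WellFounded.has_min (wellFounded_lt (α := Ordinal.{u}))
      (Set.range w) (Set.range_nonempty w)
    have hstab : ∀ i : Set.Iio κ, i₀ ≤ i → w i = w i₀ := fun i hi =>
      le_antisymm ((hw i₀).2 ⟨hanti _ _ hi (hw i).1.1, (hw i).1.2⟩)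
        (not_lt.1 (hmin _ ⟨i, rfl⟩))
    have hmem : ∀ i : Set.Iio κ, w i₀ ∈ D i := fun i => by
      rcases le_total i i₀ with h | h
      · exact hanti _ _ h (hw i₀).1.1
      · rw [← hstab i h]
        exact (hw i).1.1
    have hgr : IsGreatest ({x | x < δ ∧ ∀ i : Set.Iio κ, x ∈ D i} ∩ Set.Iic γ) (w i₀) :=
      ⟨⟨⟨(Set.mem_Iic.1 (hw i₀).1.2).trans_lt hγ, hmem⟩, (hw i₀).1.2⟩,
        fun x hx => (hw i₀).2 ⟨hx.1.2 i₀, hx.2⟩⟩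
    refine ⟨i₀, i₀.2, fun i hi hle v => ?_⟩
    have h1 := hw ⟨i, hi⟩
    rw [hstab ⟨i, hi⟩ hle] at h1
    exact ⟨fun h => h.unique h1 ▸ hgr, fun h => h.unique hgr ▸ h1⟩
  · push Not at hne
    obtain ⟨i₀, hi₀, hemp⟩ := hne
    refine ⟨i₀, hi₀, fun i hi hle v => ⟨fun h => ?_, fun h => ?_⟩⟩
    · have : v ∈ D i₀ ∩ Set.Iic γ := ⟨hanti _ _ hle h.1.1, h.1.2⟩
      rw [hemp] at this
      exact this.elim
    · have : v ∈ D i₀ ∩ Set.Iic γ := ⟨h.1.1.2 ⟨i₀, hi₀⟩, h.1.2⟩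
      rw [hemp] at this
      exact this.elim

/-- The decreasing chain of subsets of `δ` obtained by iterating `E` and intersecting. -/
def clubChain (δ : Ordinal.{u}) (E : Set Ordinal.{u} → Set Ordinal.{u}) (i : Ordinal.{u}) :
    Set Ordinal.{u} :=
  {x | x < δ ∧ ∀ j, ∀ _ : j < i, x ∈ E (clubChain δ E j)}
termination_by i

theorem mem_clubChain {δ x i : Ordinal.{u}} {E : Set Ordinal.{u} → Set Ordinal.{u}} :
    x ∈ clubChain δ E i ↔ x < δ ∧ ∀ j < i, x ∈ E (clubChain δ E j) := by
  rw [clubChain]; rfl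

theorem isClubIn_clubChain {c : Cardinal.{u}} (hc : c.IsRegular) (hω : ℵ₀ < c)
    {E : Set Ordinal.{u} → Set Ordinal.{u}} (hE : ∀ D, IsClubIn D c.ord → IsClubIn (E D) c.ord)
    (i : Ordinal.{u}) (hi : i < c.ord) : IsClubIn (clubChain c.ord E i) c.ord := by
  induction i using WellFoundedLT.induction with
  | ind i ih =>
    have := isClubIn_iInter hc hω (mk_Iio_lt hi) (fun j : Set.Iio i => E (clubChain c.ord E j))
      (fun j => hE _ (ih j j.2 (lt_trans j.2 hi)))
    convert this using 1
    ext x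
    rw [mem_clubChain]
    simp

theorem exists_dropGuesses {lam : Cardinal.{u}} (hreg : lam.IsRegular)
    {C : Ordinal.{u} → Set Ordinal.{u}} (hC : IsSquareSeq lam C) {θ : Ordinal.{u}}
    (hθ : θ < lam.ord) (hθl : IsSuccLimit θ) :
    ∃ D, IsClubIn D (succ lam).ord ∧ DropGuesses lam C D θ := by
  have hreg' := isRegular_succ hreg.aleph0_le
  have hω : ℵ₀ < succ lam := hreg.aleph0_le.trans_lt (lt_succ lam)
  have hlam : lam.ord < (succ lam).ord := Cardinal.ord_lt_ord.2 (lt_succ lam)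
  have hlim := Cardinal.isSuccLimit_ord hreg.aleph0_le
  by_contra! hcon
  have hex : ∀ D : Set Ordinal.{u}, ∃ E, IsClubIn D (succ lam).ord →
      IsClubIn E (succ lam).ord ∧ ∀ β < (succ lam).ord, IsAccOf D β →
        otp (dropSeq D C β) = Ordinal.lift.{u + 1} θ → ¬ dropSeq D C β ⊆ E := by
    intro D
    by_cases hD : IsClubIn D (succ lam).ord
    · have := hcon D hD
      unfold DropGuesses at this
      push Not at this
      obtain ⟨E, hE, h⟩ := this
      exact ⟨E, fun _ => ⟨hE, h⟩⟩
    · exact ⟨∅, fun h => absurd h hD⟩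
  choose E hE using hex
  set D := clubChain (succ lam).ord E with hDdef
  have hD : ∀ i < (succ lam).ord, IsClubIn (D i) (succ lam).ord :=
    isClubIn_clubChain hreg' hω fun X hX => (hE X hX).1
  have hanti : ∀ i j, i ≤ j → D j ⊆ D i := fun i j hij x hx => by
    rw [hDdef, mem_clubChain] at hx ⊢
    exact ⟨hx.1, fun k hk => hx.2 k (hk.trans_le hij)⟩
  set Dω : Set Ordinal.{u} := {x | x < (succ lam).ord ∧ ∀ i : Set.Iio lam.ord, x ∈ D i}
  have hDω : IsClubIn Dω (succ lam).ord :=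
    isClubIn_iInter hreg' hω (mk_Iio_lt hlam) (fun i : Set.Iio lam.ord => D i)
      fun i => hD i (lt_trans i.2 hlam)
  have hsq := isSquareSeq_dropSeq hDω hC
  obtain ⟨α, hα, hacc, hotp⟩ := exists_lt_otp_dropSeq hreg hC hDω hθ
  obtain ⟨o, e, he⟩ := hsq.exists_enumeratesSeq
  obtain ⟨o', e', he'⟩ := hC.exists_enumeratesSeq
  have hθo : θ < o α := by
    rwa [(he α hα hacc.isSuccLimit).2.2.otp_eq, Ordinal.lift_lt] at hotp
  obtain ⟨hβacc, hβα, -, hoβ, -⟩ := he.coherent hsq hα hacc.isSuccLimit hθo hθl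
  set β := e α θ
  have hβ := hβα.trans hα
  obtain ⟨hβD, hβC⟩ := isAccOf_of_dropSeq hacc hβacc
  have hotpβ : otp (dropSeq Dω C β) = Ordinal.lift.{u + 1} θ := by
    rw [(he β hβ hβacc.isSuccLimit).2.2.otp_eq, hoβ]
  have hCα := hC α hα hacc.isSuccLimit
  have hβmem : β ∈ C α := hCα.1.2 β hβα hβC
  -- `C β` is a proper initial segment of `C α`, whose order type is at most `λ`.
  have hcard : #(C β) < Cardinal.lift.{u + 1} lam := by
    obtain ⟨ho', -, hE'⟩ := he' α hα hacc.isSuccLimit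
    obtain ⟨k, hk, hkβ⟩ := hE'.surj β hβmem
    have := (hE'.inter_Iio hk).otp_eq
    rw [hkβ, ← hCα.2.2 β ⟨hβmem, hβC⟩] at this
    rw [← card_otp, this, ← Ordinal.lift_card, Cardinal.lift_lt]
    exact Cardinal.lt_ord.1 (hk.trans_le ho')
  have hst := fun γ : C β => exists_stable_isGreatest hlim.bot_lt D
    (fun i hi => hD i (hi.trans hlam)) hanti
    (lt_trans ((hC β hβ hβacc.isSuccLimit).1.1.1 γ.2) hβ)
  choose i hi hstab using hst
  obtain ⟨b, hb, hib⟩ := exists_bound hreg hcard i hi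
  have hβDb : IsAccOf (D b) β := hβD.mono fun x hx => hx.2 ⟨b, hb⟩
  -- Every `γ ∈ C β` has stabilised by stage `b`. The common value lies in `D (b + 1)`, hence in the
  -- counterexample `E (D b)`.
  have heq : dropSeq (D b) C β = dropSeq Dω C β := by
    ext v
    rw [mem_dropSeq hβDb, mem_dropSeq hβD]
    exact exists_congr fun γ => and_congr_right fun hγ =>
      hstab ⟨γ, hγ⟩ b hb (hib ⟨γ, hγ⟩).le v
  refine (hE (D b) (hD b (hb.trans hlam))).2 β hβ hβDb (heq ▸ hotpβ) ?_
  rw [heq]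
  intro v hv
  have := (dropSeq_subset hβD hv).2 ⟨succ b, hlim.succ_lt hb⟩
  rw [hDdef, mem_clubChain] at this
  exact this.2 b (lt_succ b)

/-- Guessing `E ∩ D'` with `D` yields a dropped set inside `D'`; then the maxima taken in `D` and in
`D'` coincide. This allows one `D` to serve all `θ < λ`, by intersecting. -/
theorem DropGuesses.mono {lam : Cardinal.{u}} {C : Ordinal.{u} → Set Ordinal.{u}}
    (hC : IsSquareSeq lam C) {D D' : Set Ordinal.{u}} {θ : Ordinal.{u}}
    (hD : IsClubIn D (succ lam).ord) (h : DropGuesses lam C D θ)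
    (hreg : lam.IsRegular)
    (hD' : IsClubIn D' (succ lam).ord) (hsub : D' ⊆ D) : DropGuesses lam C D' θ := by
  intro E hE
  have hreg' := isRegular_succ hreg.aleph0_le
  have hω : ℵ₀ < succ lam := hreg.aleph0_le.trans_lt (lt_succ lam)
  obtain ⟨β, hβ, hacc, hotp, hβE⟩ := h _ (isClubIn_iInter hreg' hω (ι := ULift.{u + 1} Bool)
    ((Cardinal.lt_aleph0_of_finite _).trans (by simpa using hω)) (fun b => if b.down then E else D')
    (fun b => by rcases b with ⟨_ | _⟩ <;> simpa))
  have h1 : dropSeq D C β ⊆ E := fun v hv => by simpa using (hβE hv).2 ⟨true⟩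
  have h2 : dropSeq D C β ⊆ D' := fun v hv => by simpa using (hβE hv).2 ⟨false⟩
  have hcof := (isSquareSeq_dropSeq hD hC β hβ hacc.isSuccLimit).1.1
  have hacc' : IsAccOf D' β := isAccOf_iff.2 ⟨hacc.isSuccLimit.ne_bot, fun ξ hξ =>
    let ⟨d, hd, h'⟩ := hcof.exists_gt hacc.isSuccLimit hξ
    ⟨d, h2 hd, h'⟩⟩
  have heq : dropSeq D' C β = dropSeq D C β := by
    ext v
    rw [mem_dropSeq hacc, mem_dropSeq hacc']
    refine exists_congr fun γ => and_congr_right fun hγ => ⟨fun hv => ?_, fun hv => ?_⟩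
    · obtain ⟨w, hw⟩ := hD.exists_isGreatest
        (lt_trans ((hC β hβ hacc.isSuccLimit).1.1.1 hγ) hβ) (hsub hv.1.1) hv.1.2
      have hwD : w ∈ D' := h2 ((mem_dropSeq hacc).2 ⟨γ, hγ, hw⟩)
      have : v = w := le_antisymm (hw.2 ⟨hsub hv.1.1, hv.1.2⟩) (hv.2 ⟨hwD, hw.1.2⟩)
      exact this ▸ hw
    · exact ⟨⟨h2 ((mem_dropSeq hacc).2 ⟨γ, hγ, hv⟩), hv.1.2⟩, fun x hx => hv.2 ⟨hsub hx.1, hx.2⟩⟩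
  exact ⟨β, hβ, hacc', heq ▸ hotp, heq ▸ h1⟩

/-- A square sequence which guesses clubs at every limit order type below `lam`. -/
theorem exists_isSquareSeq_club_guessing {lam : Cardinal.{u}} (hreg : lam.IsRegular)
    (h : Square lam) : ∃ C : Ordinal.{u} → Set Ordinal.{u}, IsSquareSeq lam C ∧
      ∀ θ < lam.ord, IsSuccLimit θ → ∀ E, IsClubIn E (succ lam).ord →
        ∃ β < (succ lam).ord, IsSuccLimit β ∧ otp (C β) = Ordinal.lift.{u + 1} θ ∧ C β ⊆ E := by
  obtain ⟨C, hC⟩ := h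
  have hreg' := isRegular_succ hreg.aleph0_le
  have hω : ℵ₀ < succ lam := hreg.aleph0_le.trans_lt (lt_succ lam)
  have hlam : lam.ord < (succ lam).ord := Cardinal.ord_lt_ord.2 (lt_succ lam)
  have hex : ∀ θ : Set.Iio lam.ord, ∃ D, IsClubIn D (succ lam).ord ∧
      (IsSuccLimit θ.1 → DropGuesses lam C D θ) := by
    intro θ
    by_cases hθ : IsSuccLimit θ.1
    · obtain ⟨D, h1, h2⟩ := exists_dropGuesses hreg hC θ.2 hθ
      exact ⟨D, h1, fun _ => h2⟩
    · refine ⟨Set.Iio (succ lam).ord, ⟨⟨subset_rfl, fun β hβ => ⟨β, hβ, le_rfl⟩⟩,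
        fun β hβ _ => hβ⟩, fun h => absurd h hθ⟩
  choose D hD hg using hex
  have hD' := isClubIn_iInter hreg' hω (mk_Iio_lt hlam) D hD
  refine ⟨_, isSquareSeq_dropSeq hD' hC, fun θ hθ hθl E hE => ?_⟩
  obtain ⟨β, hβ, hacc, h'⟩ := (hg ⟨θ, hθ⟩ hθl).mono hC (hD _) hreg hD' (fun x hx => hx.2 _) E hE
  exact ⟨β, hβ, hacc.isSuccLimit, h'⟩


/-! ### Guessing families of unbounded sets inside the intervals of a club. -/

open Classical in
/-- A choice of a point of the interval `(p, q]`, read off from `a` when possible. -/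
noncomputable def clampPoint (p q a : Ordinal.{u}) : Ordinal.{u} :=
  if p < a ∧ a ≤ q then a else q

theorem lt_clampPoint {p q : Ordinal.{u}} (a : Ordinal.{u}) (h : p < q) : p < clampPoint p q a := by
  unfold clampPoint
  split_ifs with h'
  exacts [h'.1, h]

theorem clampPoint_le (p q a : Ordinal.{u}) : clampPoint p q a ≤ q := by
  unfold clampPoint
  split_ifs with h'
  exacts [h'.2, le_rfl]

theorem clampPoint_eq {p q a : Ordinal.{u}} (h1 : p < a) (h2 : a ≤ q) : clampPoint p q a = a :=
  if_pos ⟨h1, h2⟩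

theorem exists_function_onto_Iio {lam : Cardinal.{u}} {q : Ordinal.{u}}
    (hq : q < (succ lam).ord) :
    ∃ f : Set.Iio lam.ord → Ordinal.{u}, ∀ η < q, ∃ j, f j = η := by
  have hle : #(Set.Iio q) ≤ #(Set.Iio lam.ord) := by
    rw [Cardinal.mk_Iio_ordinal, Cardinal.mk_Iio_ordinal, Cardinal.lift_le, Cardinal.card_ord]
    exact lt_succ_iff.1 (Cardinal.lt_ord.1 hq)
  obtain ⟨k⟩ := hle
  exact ⟨Function.extend k Subtype.val fun _ => 0, fun η hη =>
    ⟨k ⟨η, hη⟩, k.injective.extend_apply _ _ _⟩⟩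

theorem exists_interval_guess {lam : Cardinal.{u}} (hreg : lam.IsRegular)
    {C : Ordinal.{u} → Set Ordinal.{u}} {o : Ordinal.{u} → Ordinal.{u}}
    {e : Ordinal.{u} → Ordinal.{u} → Ordinal.{u}} (he : EnumeratesSeq lam C o e)
    {σ θ : Ordinal.{u}} (hθl : IsSuccLimit θ) (hpow : lam ^ θ.card ≤ lam)
    (hpow' : (succ lam) ^ lam = succ lam)
    (hguess : ∀ E, IsClubIn E (succ lam).ord → ∃ β < (succ lam).ord, IsSuccLimit β ∧
      otp (C β) = Ordinal.lift.{u + 1} (σ + θ) ∧ C β ⊆ E)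
    (hθ : θ < lam.ord) :
    ∃ Ψ : Ordinal.{u} → Ordinal.{u} → Ordinal.{u} → Ordinal.{u},
      (∀ p q i, p < q → p < Ψ p q i ∧ Ψ p q i ≤ q) ∧
      ∀ A : Ordinal.{u} → Set Ordinal.{u}, (∀ i < lam.ord, IsCofinalIn (A i) (succ lam).ord) →
        ∀ D : Set Ordinal.{u}, IsClubIn D (succ lam).ord →
        ∃ α < (succ lam).ord, IsSuccLimit α ∧ o α = σ + θ ∧ ∀ i < θ,
          Ψ (e α (σ + i)) (e α (σ + succ i)) i ∈ A i ∧
            ∃ d ∈ D, e α (σ + i) < d ∧ d < Ψ (e α (σ + i)) (e α (σ + succ i)) i := by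
  have hinf := hreg.aleph0_le
  have hreg' := isRegular_succ hinf
  have hω : ℵ₀ < succ lam := hinf.trans_lt (lt_succ lam)
  have hlim := Cardinal.isSuccLimit_ord hreg'.aleph0_le
  -- `K` holds a witness for each rule `h` and index `i`; `g` below codes elements of `K` by
  -- ordinals under `λ⁺`, and `dec` decodes them.
  let H := Set.Iio θ → Set.Iio lam.ord
  let K := H × Set.Iio θ → Set.Iio (succ lam).ord
  have hHθ : #(H × Set.Iio θ) ≤ Cardinal.lift.{u + 1} lam := by
    have hH : #H ≤ Cardinal.lift.{u + 1} lam := by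
      rw [← Cardinal.power_def, Cardinal.mk_Iio_ordinal, Cardinal.mk_Iio_ordinal, Cardinal.card_ord,
        ← Cardinal.lift_power, Cardinal.lift_le]
      exact hpow
    rw [mk_prod, Cardinal.lift_id, Cardinal.lift_id]
    refine (mul_le_mul' hH (mk_Iio_lt hθ).le).trans ?_
    rw [Cardinal.mul_eq_self (by simpa using hinf)]
  have hK : #K ≤ #(Set.Iio (succ lam).ord) := by
    have hI : #(Set.Iio (succ lam).ord) = Cardinal.lift.{u + 1} (succ lam) := by
      rw [Cardinal.mk_Iio_ordinal, Cardinal.card_ord]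
    rw [← Cardinal.power_def, hI]
    calc _ ≤ Cardinal.lift.{u + 1} (succ lam) ^ Cardinal.lift.{u + 1} lam :=
          Cardinal.power_le_power_left (by simp) hHθ
      _ = _ := by rw [← Cardinal.lift_power, hpow']
  obtain ⟨g⟩ := hK
  let dec : Ordinal.{u} → K :=
    Function.extend (fun k : K => (g k : Ordinal.{u})) id fun _ _ => ⟨0, hlim.bot_lt⟩
  have hdec : ∀ k : K, dec (g k) = k := fun k =>
    (Subtype.val_injective.comp g.injective).extend_apply id _ k
  have hf : ∀ q : Ordinal.{u}, ∃ f : Set.Iio lam.ord → Ordinal.{u},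
      q < (succ lam).ord → ∀ η < q, ∃ j, f j = η := fun q => by
    by_cases hq : q < (succ lam).ord
    · obtain ⟨f, hf⟩ := exists_function_onto_Iio hq
      exact ⟨f, fun _ => hf⟩
    · exact ⟨fun _ => 0, fun h => absurd h hq⟩
  choose f hf using hf
  -- The ordinal `h i < λ` names, through the surjection `f q`, a code below `q`; the rule decodes
  -- it and takes the coordinate at `(h, i)` itself. Clamping keeps the value in `(p, q]` even for
  -- meaningless codes.
  let Ψ : H → Ordinal.{u} → Ordinal.{u} → Ordinal.{u} → Ordinal.{u} := fun h p q i =>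
    clampPoint p q (if hi : i ∈ Set.Iio θ then (dec (f q (h ⟨i, hi⟩)) (h, ⟨i, hi⟩)).1 else q)
  by_contra! hcon
  have hbad := fun h : H => hcon (Ψ h) fun p q i hpq => ⟨lt_clampPoint _ hpq, clampPoint_le _ _ _⟩
  choose A hA D hD hfail using hbad
  have hX : ∀ γ : Ordinal.{u}, ∃ k : K, γ < (succ lam).ord → ∀ p : H × Set.Iio θ,
      (k p).1 ∈ A p.1 p.2 ∧ ∃ d ∈ D p.1, γ < d ∧ d < k p := by
    intro γ
    by_cases hγ : γ < (succ lam).ord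
    · have : ∀ p : H × Set.Iio θ, ∃ ξ : Set.Iio (succ lam).ord,
          ξ.1 ∈ A p.1 p.2 ∧ ∃ d ∈ D p.1, γ < d ∧ d < ξ := by
        intro p
        obtain ⟨d, hd, h1, h2⟩ := (hD p.1).1.exists_gt hlim hγ
        obtain ⟨ξ, hξ, h3, h4⟩ := (hA p.1 p.2 (lt_trans p.2.2 hθ)).exists_gt hlim h2
        exact ⟨⟨ξ, h4⟩, hξ, d, hd, h1, h3⟩
      choose k hk using this
      exact ⟨k, fun _ => hk⟩
    · exact ⟨fun _ => ⟨0, hlim.bot_lt⟩, fun h => absurd h hγ⟩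
  choose X hX using hX
  -- A closure point above `γ` exceeds both the code of `X γ` (at `none`) and all the witnesses it
  -- codes.
  let G : Option (H × Set.Iio θ) → Ordinal.{u} → Ordinal.{u} := fun p γ =>
    p.elim (g (X γ) : Ordinal.{u}) fun p => X γ p
  have hE := isClubIn_closure_points hreg' hω (ι := Option (H × Set.Iio θ)) (by
    rw [mk_option]
    refine Cardinal.add_lt_of_lt (Cardinal.aleph0_le_lift.2 hω.le) (hHθ.trans_lt (by simp)) ?_
    exact Cardinal.one_lt_aleph0.trans (by simpa using hω)) G (by
      rintro (_ | p) γ -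
      · exact (g (X γ)).2
      · exact (X γ p).2)
  obtain ⟨α, hα, hαl, hotp, hsub⟩ := hguess _ hE
  obtain ⟨-, -, hEn⟩ := he α hα hαl
  rw [hEn.otp_eq, Ordinal.lift_inj] at hotp
  have hi' : ∀ i < θ, σ + i < o α := fun i hi => by rw [hotp]; gcongr
  have hq : ∀ i < θ, e α (σ + succ i) < (succ lam).ord ∧ e α (σ + i) < e α (σ + succ i) ∧
      ∀ γ < e α (σ + succ i), ∀ p, G p γ < e α (σ + succ i) := fun i hi => by
    have h1 := hi' _ (hθl.succ_lt hi)
    have h2 := hsub (hEn.mem _ h1)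
    exact ⟨h2.1, hEn.lt _ _ (by gcongr; exact lt_succ i) h1, h2.2⟩
  -- This determines the diagonal `h`: its rule recovers `X` at the left endpoint of each interval,
  -- contradicting that `h` fails.
  have hh : ∀ i : Set.Iio θ, ∃ j, f (e α (σ + succ i.1)) j = g (X (e α (σ + i))) := fun i =>
    hf _ (hq i i.2).1 _ ((hq i i.2).2.2 _ (hq i i.2).2.1 none)
  choose h hh using hh
  obtain ⟨i, hi, hno⟩ := hfail h α hα hαl hotp
  obtain ⟨hq1, hq2, hq3⟩ := hq i hi
  obtain ⟨hXA, d, hd, h1, h2⟩ := hX _ (hq2.trans hq1) (h, ⟨i, hi⟩)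
  have hΨ : Ψ h (e α (σ + i)) (e α (σ + succ i)) i = (X (e α (σ + i)) (h, ⟨i, hi⟩)).1 := by
    have : (dec (f (e α (σ + succ i)) (h ⟨i, hi⟩)) (h, ⟨i, hi⟩)).1 =
        (X (e α (σ + i)) (h, ⟨i, hi⟩)).1 := by
      rw [hh ⟨i, hi⟩, hdec]
    simp only [Ψ]
    rw [dif_pos (Set.mem_Iio.2 hi), this]
    exact clampPoint_eq (h1.trans h2) (hq3 _ hq2 (some (h, ⟨i, hi⟩))).le
  rw [hΨ] at hno
  exact absurd h2 (not_lt.2 (hno hXA d hd h1))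


/-! ### Blocks of order types, and gluing the rules into one square sequence. -/

/-- `o` belongs to the `μ`-th block of the ordinals, the half-open interval `(ω ^ μ, ω ^ (μ + 1)]`. -/
def InBlock (o μ : Ordinal.{u}) : Prop :=
  ω ^ μ < o ∧ o ≤ ω ^ succ μ

theorem InBlock.unique {o μ ν : Ordinal.{u}} (h : InBlock o μ) (h' : InBlock o ν) : μ = ν := by
  have key : ∀ {μ ν : Ordinal.{u}}, InBlock o μ → InBlock o ν → μ ≤ ν := fun h h' =>
    lt_succ_iff.1 ((opow_lt_opow_iff_right one_lt_omega0).1 (h.1.trans_le h'.2))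
  exact le_antisymm (key h h') (key h' h)

theorem not_inBlock_opow {ν μ : Ordinal.{u}} (hν : IsSuccLimit ν) : ¬ InBlock (ω ^ ν) μ := by
  rintro ⟨h1, h2⟩
  rw [opow_lt_opow_iff_right one_lt_omega0] at h1
  rw [opow_le_opow_iff_right one_lt_omega0] at h2
  exact absurd (hν.succ_lt h1) (not_lt.2 h2)

theorem exists_inBlock_or_eq_opow {o : Ordinal.{u}} (ho : IsSuccLimit o) :
    (∃ μ, InBlock o μ) ∨ ∃ ν : Ordinal.{u}, IsSuccLimit ν ∧ o = ω ^ ν := by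
  obtain ⟨ν, hν, hmin⟩ := WellFounded.has_min (wellFounded_lt (α := Ordinal.{u}))
    {ν : Ordinal.{u} | o ≤ ω ^ ν} ⟨o, right_le_opow o one_lt_omega0⟩
  have hmin' : ∀ μ < ν, ω ^ μ < o := fun μ hμ => not_le.1 fun h => hmin μ h hμ
  induction ν using Ordinal.limitRecOn with
  | zero =>
    rw [Set.mem_ofPred_eq, opow_zero] at hν
    exact absurd (one_lt_of_isSuccLimit ho) (not_lt.2 hν)
  | add_one μ => exact Or.inl ⟨μ, hmin' μ (lt_succ μ), hν⟩
  | limit ν hl =>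
    refine Or.inr ⟨ν, hl, le_antisymm hν (not_lt.1 fun h => ?_)⟩
    obtain ⟨c, hc, h'⟩ := (lt_opow_of_isSuccLimit omega0_ne_zero hl).1 h
    exact lt_asymm h' (hmin' c hc)

open Classical in
/-- Replace the values of an enumeration `E` at successor indices by the points chosen by `Ψ`. -/
noncomputable def perturb (Ψ : Ordinal.{u} → Ordinal.{u} → Ordinal.{u} → Ordinal.{u})
    (E : Ordinal.{u} → Ordinal.{u}) (i : Ordinal.{u}) : Ordinal.{u} :=
  if h : ∃ k, i = succ k then Ψ (E h.choose) (E (succ h.choose)) h.choose else E i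

section perturb

variable {Ψ : Ordinal.{u} → Ordinal.{u} → Ordinal.{u} → Ordinal.{u}}
  {E E' : Ordinal.{u} → Ordinal.{u}}

theorem perturb_succ (k : Ordinal.{u}) : perturb Ψ E (succ k) = Ψ (E k) (E (succ k)) k := by
  have h : ∃ l, succ k = succ l := ⟨k, rfl⟩
  have hk : h.choose = k := (succ_injective h.choose_spec).symm
  rw [perturb, dif_pos h, hk]

theorem perturb_of_not_succ {i : Ordinal.{u}} (h : ¬ ∃ k, i = succ k) : perturb Ψ E i = E i :=
  dif_neg h

theorem perturb_of_isSuccLimit {i : Ordinal.{u}} (h : IsSuccLimit i) : perturb Ψ E i = E i :=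
  perturb_of_not_succ fun ⟨k, hk⟩ => absurd (h.succ_lt (hk ▸ lt_succ k)) (hk ▸ lt_irrefl _)

theorem perturb_congr {i : Ordinal.{u}} (h : ∀ k ≤ i, E k = E' k) :
    perturb Ψ E i = perturb Ψ E' i := by
  by_cases hi : ∃ k, i = succ k
  · obtain ⟨k, rfl⟩ := hi
    rw [perturb_succ, perturb_succ, h k (le_succ k), h _ le_rfl]
  · rw [perturb_of_not_succ hi, perturb_of_not_succ hi, h _ le_rfl]

theorem perturb_le (hΨ : ∀ p q i, p < q → p < Ψ p q i ∧ Ψ p q i ≤ q) {o i : Ordinal.{u}}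
    (hE : ∀ i j, i < j → j < o → E i < E j) (hi : i < o) : perturb Ψ E i ≤ E i := by
  by_cases h : ∃ k, i = succ k
  · obtain ⟨k, rfl⟩ := h
    rw [perturb_succ]
    exact (hΨ _ _ _ (hE _ _ (lt_succ k) hi)).2
  · rw [perturb_of_not_succ h]

/-- With `perturb_le`, this interleaves the perturbed and original values, giving strict
monotonicity and the same limits. -/
theorem lt_perturb (hΨ : ∀ p q i, p < q → p < Ψ p q i ∧ Ψ p q i ≤ q) {o i k : Ordinal.{u}}
    (hE : ∀ i j, i < j → j < o → E i < E j) (hi : i < o) (hk : k < i) : E k < perturb Ψ E i := by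
  by_cases h : ∃ k, i = succ k
  · obtain ⟨l, rfl⟩ := h
    rw [perturb_succ]
    refine lt_of_le_of_lt ?_ (hΨ _ _ _ (hE _ _ (lt_succ l) hi)).1
    rcases (lt_succ_iff.1 hk).eq_or_lt with rfl | hkl
    · exact le_rfl
    · exact (hE _ _ hkl ((lt_succ l).trans hi)).le
  · rw [perturb_of_not_succ h]
    exact hE _ _ hk hi

end perturb

open Classical in
/-- The order type of the club obtained from one of order type `o` by keeping its part in the
topmost block, or the starting points of the blocks if there is no topmost block. -/
noncomputable def blockLength (o : Ordinal.{u}) : Ordinal.{u} :=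
  if h : ∃ μ, InBlock o μ then o - ω ^ h.choose else log ω o

open Classical in
/-- The enumeration of the club obtained from the one enumerated by `E` in order type `o` by
perturbing its part in the topmost block, or keeping the starting points of the blocks if there is
no topmost block. -/
noncomputable def blockEnum
    (Ψ : Ordinal.{u} → Ordinal.{u} → Ordinal.{u} → Ordinal.{u} → Ordinal.{u}) (o : Ordinal.{u})
    (E : Ordinal.{u} → Ordinal.{u}) : Ordinal.{u} → Ordinal.{u} :=
  if h : ∃ μ, InBlock o μ then perturb (Ψ h.choose) fun j => E (ω ^ h.choose + j)
  else fun i => E (ω ^ i)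

section block

variable {Ψ : Ordinal.{u} → Ordinal.{u} → Ordinal.{u} → Ordinal.{u} → Ordinal.{u}}
  {o μ ν : Ordinal.{u}} {E : Ordinal.{u} → Ordinal.{u}}

theorem InBlock.blockLength_eq (h : InBlock o μ) : blockLength o = o - ω ^ μ := by
  have hex : ∃ μ, InBlock o μ := ⟨μ, h⟩
  rw [blockLength, dif_pos hex, hex.choose_spec.unique h]

theorem InBlock.blockEnum_eq (h : InBlock o μ) :
    blockEnum Ψ o E = perturb (Ψ μ) fun j => E (ω ^ μ + j) := by
  have hex : ∃ μ, InBlock o μ := ⟨μ, h⟩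
  rw [blockEnum, dif_pos hex, hex.choose_spec.unique h]

theorem blockLength_opow (h : IsSuccLimit ν) : blockLength (ω ^ ν) = ν := by
  rw [blockLength, dif_neg fun ⟨_, h'⟩ => not_inBlock_opow h h', log_opow one_lt_omega0]

theorem blockEnum_opow (h : IsSuccLimit ν) : blockEnum Ψ (ω ^ ν) E = fun i => E (ω ^ i) := by
  rw [blockEnum, dif_neg fun ⟨_, h'⟩ => not_inBlock_opow h h']

theorem isSquareSeq_blockEnum {lam : Cardinal.{u}} {C : Ordinal.{u} → Set Ordinal.{u}}
    {o : Ordinal.{u} → Ordinal.{u}} {e : Ordinal.{u} → Ordinal.{u} → Ordinal.{u}}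
    (hC : IsSquareSeq lam C) (he : EnumeratesSeq lam C o e)
    (hΨ : ∀ μ p q i, p < q → p < Ψ μ p q i ∧ Ψ μ p q i ≤ q) :
    IsSquareSeq lam fun α => blockEnum Ψ (o α) (e α) '' Set.Iio (blockLength (o α)) := by
  refine isSquareSeq_of_enum (o := fun α => blockLength (o α))
    (e := fun α => blockEnum Ψ (o α) (e α)) fun α hα hlim => ?_
  obtain ⟨hoα, hol, hE⟩ := he α hα hlim
  have hclub := (hC α hα hlim).1
  have hcof : ∀ ξ < α, ∃ k < o α, ξ ≤ e α k := fun ξ hξ => by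
    obtain ⟨c, hc, hle⟩ := hclub.1.2 ξ hξ
    obtain ⟨k, hk, rfl⟩ := hE.surj c hc
    exact ⟨k, hk, hle⟩
  have hltα : ∀ i < o α, e α i < α := fun i hi => hclub.1.1 (hE.mem i hi)
  rcases exists_inBlock_or_eq_opow hol with ⟨μ, hμ⟩ | ⟨ν, hν, hoν⟩
  · simp only [hμ.blockLength_eq, hμ.blockEnum_eq]
    set σ : Ordinal.{u} := ω ^ μ with hσ
    have hadd : σ + (o α - σ) = o α := Ordinal.add_sub_cancel_of_le hμ.1.le
    have hlt : ∀ j < o α - σ, σ + j < o α := fun j hj => lt_sub.1 hj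
    have hlenl : IsSuccLimit (o α - σ) := isSuccLimit_sub hol.isSuccPrelimit hμ.1
    have hmono : ∀ i j, i < j → j < o α - σ → e α (σ + i) < e α (σ + j) := fun i j hij hj =>
      hE.lt _ _ (by gcongr) (hlt j hj)
    have hkle : ∀ k < o α, e α k ≤ e α (σ + (k - σ)) ∧ k - σ < o α - σ := fun k hk => by
      have h1 : k - σ < o α - σ := sub_lt_of_lt_add (by rwa [hadd]) hlenl.bot_lt
      exact ⟨(hE.le_iff hk (hlt _ h1)).2 (le_add_sub k σ), h1⟩
    refine ⟨(sub_le_self _ _).trans hoα, fun i j hij hj => ?_, fun i hi => ?_, fun ξ hξ => ?_,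
      fun j hj hjl => ?_⟩
    · exact (perturb_le (hΨ μ) hmono (hij.trans hj)).trans_lt (lt_perturb (hΨ μ) hmono hj hij)
    · exact (perturb_le (hΨ μ) hmono hi).trans_lt (hltα _ (hlt i hi))
    · obtain ⟨k, hk, hle⟩ := hcof ξ hξ
      obtain ⟨h1, h2⟩ := hkle k hk
      -- Perturbing may lower the value at `k - σ`, but the value at the next index stays above the
      -- original one.
      exact ⟨succ (k - σ), hlenl.succ_lt h2, (hle.trans h1).trans
        (lt_perturb (hΨ μ) hmono (hlenl.succ_lt h2) (lt_succ _)).le⟩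
    · rw [perturb_of_isSuccLimit hjl]
      have hσjl : IsSuccLimit (σ + j) := isSuccLimit_add σ hjl
      obtain ⟨-, -, -, hoj, hej⟩ := he.coherent hC hα hlim (hlt j hj) hσjl
      have hblock : InBlock (σ + j) μ :=
        ⟨lt_add_of_pos_right σ hjl.bot_lt, (hlt j hj).le.trans hμ.2⟩
      refine ⟨fun ξ hξ => ?_, ?_, fun i hi => ?_⟩
      · obtain ⟨m, hm, hξm⟩ := hE.exists_gt_of_isSuccLimit hclub (hlt j hj) hσjl hξ
        have hmj : m - σ < j := sub_lt_of_lt_add hm hjl.bot_lt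
        exact ⟨succ (m - σ), hjl.succ_lt hmj, (hξm.trans_le (hkle m (hm.trans (hlt j hj))).1).trans
          (lt_perturb (hΨ μ) hmono ((hjl.succ_lt hmj).trans hj) (lt_succ _))⟩
      · rw [hoj, hblock.blockLength_eq, Ordinal.add_sub_cancel]
      · rw [hoj, hblock.blockEnum_eq]
        -- The perturbed value at `i` depends only on original values at indices up to `i`, where
        -- the enumerations agree.
        exact perturb_congr fun k hk => hej _ (by gcongr; exact hk.trans_lt hi)
  · simp only [hoν, blockLength_opow hν, blockEnum_opow hν]
    have hlt : ∀ j < ν, ω ^ j < o α := fun j hj => by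
      rw [hoν]; exact (opow_lt_opow_iff_right one_lt_omega0).2 hj
    have hmono : ∀ i j : Ordinal.{u}, i < j → j < ν → e α (ω ^ i) < e α (ω ^ j) := fun i j hij hj =>
      hE.lt _ _ ((opow_lt_opow_iff_right one_lt_omega0).2 hij) (hlt j hj)
    refine ⟨(right_le_opow ν one_lt_omega0).trans (hoν ▸ hoα), hmono,
      fun i hi => hltα _ (hlt i hi), fun ξ hξ => ?_, fun j hj hjl => ?_⟩
    · obtain ⟨k, hk, hle⟩ := hcof ξ hξ
      obtain ⟨i, hi, hki⟩ := (lt_opow_of_isSuccLimit omega0_ne_zero hν).1 (hoν ▸ hk)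
      exact ⟨i, hi, hle.trans (hE.lt _ _ hki (hlt i hi)).le⟩
    · have hσjl : IsSuccLimit (ω ^ j) := isSuccLimit_opow one_lt_omega0 hjl
      obtain ⟨-, -, -, hoj, hej⟩ := he.coherent hC hα hlim (hlt j hj) hσjl
      refine ⟨fun ξ hξ => ?_, ?_, fun i hi => ?_⟩
      · obtain ⟨m, hm, hξm⟩ := hE.exists_gt_of_isSuccLimit hclub (hlt j hj) hσjl hξ
        obtain ⟨i, hi, hmi⟩ := (lt_opow_of_isSuccLimit omega0_ne_zero hjl).1 hm
        exact ⟨i, hi, hξm.trans (hE.lt _ _ hmi (hlt i (hi.trans hj)))⟩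
      · rw [hoj, blockLength_opow hjl]
      · rw [hoj, blockEnum_opow hjl]
        exact hej _ ((opow_lt_opow_iff_right one_lt_omega0).2 hi)

end block

/-! ### The Ostaszewski square. -/

theorem ostaszewskiSquare_of_isRegular {lam : Cardinal.{u}} (hreg : lam.IsRegular) (hω : ℵ₀ < lam)
    (hpow : ∀ κ < lam, lam ^ κ ≤ lam) (hpow' : (succ lam) ^ lam = succ lam) (hsq : Square lam) :
    OstaszewskiSquare lam := by
  obtain ⟨C, hC, hguess⟩ := exists_isSquareSeq_club_guessing hreg hsq
  obtain ⟨o, e, he⟩ := hC.exists_enumeratesSeq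
  have hω' : ω < lam.ord := by simpa using Cardinal.ord_lt_ord.2 hω
  have hlt : ∀ θ < lam.ord, ω ^ θ + θ < lam.ord := fun θ hθ =>
    isPrincipal_add_ord hreg.aleph0_le (isPrincipal_opow_ord hreg.aleph0_le hω' hθ) hθ
  have hex : ∀ θ : Ordinal.{u}, ∃ Ψ : Ordinal.{u} → Ordinal.{u} → Ordinal.{u} → Ordinal.{u},
      (∀ p q i, p < q → p < Ψ p q i ∧ Ψ p q i ≤ q) ∧ (θ < lam.ord → IsSuccLimit θ →
      ∀ A : Ordinal.{u} → Set Ordinal.{u}, (∀ i < lam.ord, IsCofinalIn (A i) (succ lam).ord) →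
        ∀ D : Set Ordinal.{u}, IsClubIn D (succ lam).ord →
        ∃ α < (succ lam).ord, IsSuccLimit α ∧ o α = ω ^ θ + θ ∧ ∀ i < θ,
          Ψ (e α (ω ^ θ + i)) (e α (ω ^ θ + succ i)) i ∈ A i ∧
            ∃ d ∈ D, e α (ω ^ θ + i) < d ∧ d < Ψ (e α (ω ^ θ + i)) (e α (ω ^ θ + succ i)) i) := by
    intro θ
    by_cases hθ : θ < lam.ord ∧ IsSuccLimit θ
    · obtain ⟨Ψ, h1, h2⟩ := exists_interval_guess hreg he hθ.2 (hpow _ (Cardinal.lt_ord.1 hθ.1))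
        hpow' (hguess _ (hlt θ hθ.1) (isSuccLimit_add _ hθ.2)) hθ.1
      exact ⟨Ψ, h1, fun _ _ => h2⟩
    · exact ⟨fun _ q _ => q, fun p q _ h => ⟨h, le_rfl⟩, fun h1 h2 => absurd ⟨h1, h2⟩ hθ⟩
  choose Ψ hΨ hΨg using hex
  have hsq' := isSquareSeq_blockEnum hC he hΨ
  refine ⟨_, hsq', fun A hA θ hθ hθl D hD => ?_⟩
  obtain ⟨α, hα, hαl, hoα, hA'⟩ := hΨg θ hθ hθl A hA D hD
  obtain ⟨-, -, hE⟩ := he α hα hαl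
  have hblock : InBlock (o α) θ := by
    refine ⟨hoα ▸ lt_add_of_pos_right _ hθl.bot_lt, ?_⟩
    rw [hoα, opow_succ]
    calc ω ^ θ + θ ≤ ω ^ θ + ω ^ θ := by gcongr; exact right_le_opow θ one_lt_omega0
      _ = ω ^ θ * 2 := (Ordinal.mul_two _).symm
      _ ≤ ω ^ θ * ω := by gcongr; exact (natCast_lt_omega0 2).le
  have hlen : blockLength (o α) = θ := by
    rw [hblock.blockLength_eq, hoα, Ordinal.add_sub_cancel]
  have hmono : ∀ i j, i < j → j < θ → e α (ω ^ θ + i) < e α (ω ^ θ + j) := fun i j hij hj =>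
    hE.lt _ _ (by gcongr) (by rw [hoα]; gcongr)
  have hEn : IsEnum (blockEnum Ψ (o α) (e α) '' Set.Iio (blockLength (o α))) θ
      (perturb (Ψ θ) fun j => e α (ω ^ θ + j)) := by
    rw [hlen, hblock.blockEnum_eq]
    exact isEnum_image fun i j hij hj =>
      (perturb_le (hΨ θ) hmono (hij.trans hj)).trans_lt (lt_perturb (hΨ θ) hmono hj hij)
  refine ⟨α, hα, hαl, hEn.otp_eq, fun i hi => ?_⟩
  obtain ⟨h1, d, hd, h2, h3⟩ := hA' i hi
  refine ⟨_, _, hEn.isNth hi, hEn.isNth (hθl.succ_lt hi), ?_, d, hd, ?_, ?_⟩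
  · rwa [perturb_succ]
  · exact (perturb_le (hΨ θ) hmono hi).trans_lt h2
  · rwa [perturb_succ]

end OstSq

theorem theorem3p3 (lam : Cardinal.{u}) (hinf : Cardinal.aleph0 ≤ lam)
    (hsucc : ∃ κ : Cardinal.{u}, lam = Order.succ κ)
    (hlt : Cardinal.powerlt lam lam < lam ^ lam)
    (heq : lam ^ lam = Order.succ lam)
    (hsq : OstSq.Square lam) :
    OstSq.OstaszewskiSquare lam := by
  obtain ⟨κ, rfl⟩ := hsucc
  have hκ : Cardinal.aleph0 ≤ κ := not_lt.1 fun h =>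
    absurd hinf (not_le.2 (Cardinal.isSuccLimit_aleph0.succ_lt h))
  refine OstSq.ostaszewskiSquare_of_isRegular (Cardinal.isRegular_succ hκ)
    (hκ.trans_lt (Order.lt_succ κ)) (fun μ hμ => ?_) ?_ hsq
  · rw [heq] at hlt
    exact (Cardinal.le_powerlt _ hμ).trans (Order.lt_succ_iff.1 hlt)
  -- `(λ⁺) ^ λ = (λ ^ λ) ^ λ = λ ^ λ = λ⁺`.
  · rw [← heq, ← Cardinal.power_mul, Cardinal.mul_eq_self hinf]
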